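/- Let $P$ be a right-LCM monoid, that is, a left-cancellative monoid such that for all $p,q\in P$ the set $pP\cap qP$ is either empty or of the form $rP$ for some $r\in P$; write $p\vee q=\{r\in P: pP\cap qP=rP\}$. An isometric representation $V$ of such a monoid $P$ on a Hilbert space (a unital multiplicative map into the bounded operators with $V_x^*V_x=1$ for all $x$) is Nica-covariant if, for all $x,y\in P$, $V_xV_x^*V_yV_y^*=V_rV_r^*$ for $r\in x\vee y$, and $V_xV_x^*V_yV_y^*=0$ if $x\vee y=\emptyset$. The full semigroup C*-algebra $C^*(P)$ is the universal C*-algebra generated by a Nica-covariant representation of $P$. Let $P_1\subseteq P$ be a submonoid that is closed under factorization (if $x,y\in P$ and $xy\in P_1$, then $x,y\in P_1$) and such that the inclusion preserves orthogonality (for all $x,y\in P_1$, $xP_1\cap yP_1=\emptyset$ if and only if $xP\cap yP=\emptyset$); then $P_1$ is itself a right-LCM monoid. Let $v:P_1\to C^*(P_1)$ and $w:P\to C^*(P)$ be the universal Nica-covariant representations. Then the map $v_p\mapsto w_p$, $p\in P_1$, extends to an injective, hence isometric, $*$-homomorphism of $C^*(P_1)$ onto the C*-subalgebra $C^*(\{w_p:p\in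 P_1\})$ of $C^*(P)$ generated by $\{w_p:p\in P_1\}$. -/

import Mathlib

open scoped ENNReal CStarAlgebra

noncomputable section

universe u

/-! ### Right-LCM monoids -/

/-- The principal right ideal `pP` of a monoid `P`. -/
def principalRightIdeal {P : Type*} [Monoid P] (p : P) : Set P :=
  {z | ∃ a : P, z = p * a}

/-- A right-LCM monoid: it is left cancellative, and the intersection of two principal right
ideals is either empty or again a principal right ideal. -/
structure IsRightLCM (P : Type*) [Monoid P] : Prop where
  left_cancel : ∀ p x y : P, p * x = p * y → x = y
  inter_eq : ∀ p q : P, principalRightIdeal p ∩ principalRightIdeal q = ∅ ∨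
    ∃ r : P, principalRightIdeal p ∩ principalRightIdeal q = principalRightIdeal r

/-- The set `p ∨ q` of all least common multiples of `p` and `q`, namely of those `r` for which
`pP ∩ qP = rP`. -/
def lcmSet {P : Type*} [Monoid P] (p q : P) : Set P :=
  {r | principalRightIdeal p ∩ principalRightIdeal q = principalRightIdeal r}

/-- A submonoid is closed under factorization if it contains all factors of its elements. -/
def ClosedUnderFactorization {P : Type*} [Monoid P] (P₁ : Submonoid P) : Prop :=
  ∀ x y : P, x * y ∈ P₁ → x ∈ P₁ ∧ y ∈ P₁

/-- The inclusion `P₁ ⊆ P` preserves orthogonality: for `x, y ∈ P₁`, the ideals `xP₁` and `yP₁`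
are disjoint if and only if `xP` and `yP` are. -/
def PreservesOrthogonality {P : Type*} [Monoid P] (P₁ : Submonoid P) : Prop :=
  ∀ x y : P₁, principalRightIdeal x ∩ principalRightIdeal y = ∅ ↔
    principalRightIdeal (x : P) ∩ principalRightIdeal (y : P) = ∅

/-! ### Nica-covariant representations -/

/-- A representation `V` of `P` by isometries of a *-algebra `A` (for instance, of the algebra of
bounded operators on a Hilbert space) is Nica covariant if `V_x V_x^* V_y V_y^*` is `V_r V_r^*`
when `r ∈ x ∨ y`, and is `0` when `x ∨ y = ∅`. -/
structure IsNicaCovariant {P : Type*} [Monoid P] {A : Type*} [Semiring A] [StarRing A]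
    (V : P →* A) : Prop where
  isometric : ∀ x : P, star (V x) * V x = 1
  covariant : ∀ x y r : P, r ∈ lcmSet x y →
    V x * star (V x) * (V y * star (V y)) = V r * star (V r)
  orthogonal : ∀ x y : P, lcmSet x y = ∅ →
    V x * star (V x) * (V y * star (V y)) = 0

/-- A Nica-covariant isometric representation of `P` on a nonzero complex Hilbert space. -/
structure NicaRep (P : Type u) [Monoid P] : Type (u + 1) where
  H : Type u
  [normedAddCommGroup : NormedAddCommGroup H]
  [innerProductSpace : InnerProductSpace ℂ H]
  [completeSpace : CompleteSpace H]
  [nontrivial : Nontrivial H]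
  V : P →* (H →L[ℂ] H)
  isNicaCovariant : IsNicaCovariant V

attribute [instance] NicaRep.normedAddCommGroup NicaRep.innerProductSpace
  NicaRep.completeSpace NicaRep.nontrivial

/-! ### The full semigroup C*-algebra -/

/-- The algebra `B(H)` of bounded operators on the space of a representation. -/
abbrev NicaRep.Op {P : Type u} [Monoid P] (ρ : NicaRep P) : Type u := ρ.H →L[ℂ] ρ.H

theorem NicaRep.norm_V {P : Type u} [Monoid P] (ρ : NicaRep P) (p : P) :
    ‖(ρ.V p : ρ.Op)‖ = 1 := by
  have h := CStarRing.norm_star_mul_self (x := ρ.V p)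
  rw [ρ.isNicaCovariant.isometric p, norm_one] at h
  nlinarith [norm_nonneg (ρ.V p)]

/-- The direct sum (ℓ^∞-product) of the algebras `B(H)` over all Nica-covariant representations
`P → B(H)`. -/
abbrev NicaProduct (P : Type u) [Monoid P] : Type (u + 1) :=
  lp (fun ρ : NicaRep P => ρ.Op) ∞

instance (P : Type u) [Monoid P] : CStarAlgebra (NicaProduct P) where

/-- The direct sum `p ↦ (V_p)_V` of all Nica-covariant representations. -/
def nicaSum (P : Type u) [Monoid P] : P →* NicaProduct P where
  toFun p := ⟨fun ρ => ρ.V p, memℓp_infty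
    ⟨1, by rintro _ ⟨ρ, rfl⟩; exact (ρ.norm_V p).le⟩⟩
  map_one' := by
    ext1; funext ρ; exact ρ.V.map_one
  map_mul' p q := by
    ext1; funext ρ; exact ρ.V.map_mul p q

/-- The C*-subalgebra `C*(S)` of a unital C*-algebra generated by a set `S` and the unit. -/
def generatedCStar {A : Type*} [CStarAlgebra A] (S : Set A) : StarSubalgebra ℂ A :=
  (StarAlgebra.adjoin ℂ S).topologicalClosure

instance {A : Type*} [CStarAlgebra A] (S : Set A) : IsClosed (generatedCStar S : Set A) :=
  StarSubalgebra.isClosed_topologicalClosure _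

/-- The full semigroup C*-algebra `C*(P)`: the universal C*-algebra generated by a Nica-covariant
representation of `P`, realized as the C*-algebra generated by the direct sum of all Nica-covariant
representations of `P`. Since the cyclic representations of `P` have dimension at most
`max (card P) ℵ₀`, those on Hilbert spaces in the universe of `P` determine the universal norm. -/
def FullCStar (P : Type u) [Monoid P] : Type (u + 1) :=
  generatedCStar (Set.range (nicaSum P))

instance (P : Type u) [Monoid P] : CStarAlgebra (FullCStar P) :=
  inferInstanceAs (CStarAlgebra (generatedCStar (Set.range (nicaSum P))))

/-- The universal Nica-covariant representation `P → C*(P)`. -/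
def univRep (P : Type u) [Monoid P] : P →* FullCStar P where
  toFun p := (⟨nicaSum P p, StarSubalgebra.le_topologicalClosure _
    (StarAlgebra.subset_adjoin ℂ _ ⟨p, rfl⟩)⟩ : generatedCStar (Set.range (nicaSum P)))
  map_one' := Subtype.ext (map_one (nicaSum P))
  map_mul' p q := Subtype.ext (map_mul (nicaSum P) p q)

/-! ### The universal property of `C*(P)` -/

/-- The universal representation is Nica covariant. -/
theorem univRep_isNicaCovariant (P : Type u) [Monoid P] : IsNicaCovariant (univRep P) where
  isometric x := by
    apply Subtype.ext; apply lp.ext; funext ρ; exact ρ.isNicaCovariant.isometric x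
  covariant x y r h := by
    apply Subtype.ext; apply lp.ext; funext ρ; exact ρ.isNicaCovariant.covariant x y r h
  orthogonal x y h := by
    apply Subtype.ext; apply lp.ext; funext ρ; exact ρ.isNicaCovariant.orthogonal x y h

/-- The inclusion of `C*(P)` into the product. -/
def fullCStarIncl (P : Type u) [Monoid P] : FullCStar P →⋆ₐ[ℂ] NicaProduct P :=
  (generatedCStar (Set.range (nicaSum P))).subtype

/-- `C*(P)` is generated, as a C*-algebra, by the image of the universal representation. -/
theorem generatedCStar_univRep (P : Type u) [Monoid P] :
    generatedCStar (Set.range (univRep P)) = ⊤ := by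
  have hind : Topology.IsInducing (fullCStarIncl P) := Topology.IsInducing.subtypeVal
  have himg : (fullCStarIncl P) '' (StarAlgebra.adjoin ℂ (Set.range (univRep P)) : Set (FullCStar P))
      = (StarAlgebra.adjoin ℂ (Set.range (nicaSum P)) : Set (NicaProduct P)) := by
    have h := StarAlgHom.map_adjoin (fullCStarIncl P) (Set.range (univRep P))
    rw [← Set.range_comp] at h
    exact congrArg (fun S : StarSubalgebra ℂ (NicaProduct P) => (S : Set (NicaProduct P))) h
  refine eq_top_iff.2 fun a _ => ?_
  have ha : fullCStarIncl P a ∈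
      closure (StarAlgebra.adjoin ℂ (Set.range (nicaSum P)) : Set (NicaProduct P)) := a.2
  rw [← himg] at ha
  change a ∈ closure (StarAlgebra.adjoin ℂ (Set.range (univRep P)) : Set (FullCStar P))
  rw [hind.closure_eq_preimage_closure_image]
  exact ha

/-- Evaluation of the elements of `C*(P)` in one Nica-covariant representation. -/
def NicaRep.eval {P : Type u} [Monoid P] (ρ : NicaRep P) : FullCStar P →⋆ₐ[ℂ] ρ.Op where
  toFun a := (fullCStarIncl P a).1 ρ
  map_one' := rfl
  map_mul' _ _ := rfl
  map_zero' := rfl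
  map_add' _ _ := rfl
  commutes' _ := rfl
  map_star' _ := rfl

/-- Every Nica-covariant representation of `P` on a Hilbert space factors uniquely through the
universal one. -/
theorem existsUnique_lift {P : Type u} [Monoid P] {H : Type u} [NormedAddCommGroup H]
    [InnerProductSpace ℂ H] [CompleteSpace H] (V : P →* (H →L[ℂ] H)) (hV : IsNicaCovariant V) :
    ∃! π : FullCStar P →⋆ₐ[ℂ] (H →L[ℂ] H), ∀ p : P, π (univRep P p) = V p := by
  have hex : ∃ π : FullCStar P →⋆ₐ[ℂ] (H →L[ℂ] H), ∀ p : P, π (univRep P p) = V p := by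
    rcases subsingleton_or_nontrivial H with hH | hH
    · exact ⟨{ toFun := fun _ => 0
               map_one' := Subsingleton.elim _ _
               map_mul' := fun _ _ => Subsingleton.elim _ _
               map_zero' := rfl
               map_add' := fun _ _ => Subsingleton.elim _ _
               commutes' := fun _ => Subsingleton.elim _ _
               map_star' := fun _ => Subsingleton.elim _ _ }, fun _ => Subsingleton.elim _ _⟩
    · exact ⟨NicaRep.eval { H := H, V := V, isNicaCovariant := hV }, fun _ => rfl⟩
  obtain ⟨π, hπ⟩ := hex
  refine ⟨π, hπ, fun π' hπ' => ?_⟩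
  have hc : IsClosed (StarAlgHom.equalizer π' π : Set (FullCStar P)) :=
    isClosed_eq (map_continuous π') (map_continuous π)
  have hle : generatedCStar (Set.range (univRep P)) ≤ StarAlgHom.equalizer π' π := by
    refine StarSubalgebra.topologicalClosure_minimal (StarAlgebra.adjoin_le ?_) hc
    rintro _ ⟨p, rfl⟩
    exact (hπ' p).trans (hπ p).symm
  rw [generatedCStar_univRep] at hle
  ext1 a
  exact hle (StarSubalgebra.mem_top (x := a))

end

noncomputable section

universe u

/-! ### Operators on reproducing kernel Hilbert spaces -/

section ReproducingKernel

variable {X V E : Type*} [NormedAddCommGroup V] [InnerProductSpace ℂ V] [CompleteSpace V]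
  [NormedAddCommGroup E] [InnerProductSpace ℂ E] [CompleteSpace E] [RKHS ℂ E X V]

/-! The map exists because least common multiples and orthogonality in `P₁` agree with those in `P`,
so Nica-covariant representations of `P` restrict to `P₁`. The content is injectivity: every
Nica-covariant representation V of `P₁` on H must be recovered from one of `P`, by dilation.

Extend V by zero to T on `P`; this is multiplicative because xy lies in `P₁` exactly when x and y
do. Put K(q,p) = T_b T_a^* if qb = pa is a least common multiple, and K(q,p) = 0 if q and p have no
common multiple (`lcmKernel`). If K is positive, it is the kernel of a Hilbert space E with dense
span of vectors k_p v, where k_q^* k_p = K(q,p). Since K(sq,sp) = K(q,p), the rule W_x k_p v =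
k_{xp} v defines isometries, and these form a Nica-covariant representation of `P`
(`exists_nica_on_rkhs`). As K(1,1) = 1, the map j = k_1 embeds H in E, and for s in `P₁` both W_s j
= j V_s and W_s^* j = j V_s^*. So V factors through `C*(P)` on the image of `C*(P₁)`, and nothing
that V detects is lost.

Positivity is the crux (`posSemidef_of_comm`, `lcmKernel_comm`). Formally, p ↦ k_p k_p^* should be
commuting projections, which reads K(q,p)K(p,s) = K(q,p)K(p,q)K(q,s). Extension by zero makes this
identity hold: K(q,p) vanishes unless both cofactors a, b lie in `P₁`, and then translation by them
is available. -/

theorem clm_ext_kerFun {F : Type*} [NormedAddCommGroup F] [NormedSpace ℂ F] {A B : E →L[ℂ] F}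
    (h : ∀ x v, A (RKHS.kerFun E x v) = B (RKHS.kerFun E x v)) : A = B := by
  refine ContinuousLinearMap.ext_on (s := {RKHS.kerFun E x v | (x : X) (v : V)}) ?_ ?_
  · rw [dense_iff_closure_eq]
    have := RKHS.kerFun_dense (𝕜 := ℂ) E (X := X) (V := V)
    rw [← Submodule.topologicalClosure_coe, this]; rfl
  · rintro _ ⟨x, v, rfl⟩
    exact h x v

theorem inner_kerFun_kerFun (x y : X) (v w : V) :
    inner ℂ (RKHS.kerFun E x v) (RKHS.kerFun E y w) = inner ℂ (RKHS.kernel E y x v) w := by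
  rw [RKHS.kernel_inner]

/-- A self-map of the index set that preserves the kernel acts by translation of the kernel
functions. -/
theorem exists_translation (σ : X → X)
    (hσ : ∀ x y, RKHS.kernel E (σ x) (σ y) = RKHS.kernel E x y) :
    ∃ W : E →L[ℂ] E, ∀ x v, W (RKHS.kerFun E x v) = RKHS.kerFun E (σ x) v := by
  let e : (X × V →₀ ℂ) →ₗ[ℂ] E := Finsupp.linearCombination ℂ fun xv => RKHS.kerFun E xv.1 xv.2
  let f : (X × V →₀ ℂ) →ₗ[ℂ] E := Finsupp.linearCombination ℂ fun xv => RKHS.kerFun E (σ xv.1) xv.2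
  -- Norms of finite combinations depend only on the kernel, so invariance under σ makes the
  -- translation isometric, hence well defined, on a dense subspace.
  have hinner : ∀ a, inner ℂ (f a) (f a) = inner ℂ (e a) (e a) := by
    intro a
    simp only [e, f, Finsupp.linearCombination_apply, Finsupp.sum_inner, Finsupp.inner_sum,
      inner_smul_left, inner_smul_right, inner_kerFun_kerFun, hσ]
  have hnorm : ∀ a, ‖f a‖ ≤ 1 * ‖e a‖ := by
    intro a
    rw [one_mul, @norm_eq_sqrt_re_inner ℂ, @norm_eq_sqrt_re_inner ℂ _ _ _ _ (e a), hinner]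
  have hdense : DenseRange e := by
    have h := RKHS.kerFun_dense (𝕜 := ℂ) E (X := X) (V := V)
    have hr : (LinearMap.range e : Set E) =
        Submodule.span ℂ {RKHS.kerFun E x v | (x : X) (v : V)} := by
      rw [Finsupp.range_linearCombination]
      congr 2
      ext z; simp
    rw [DenseRange, ← LinearMap.coe_range, hr, dense_iff_closure_eq,
      ← Submodule.topologicalClosure_coe, h]; rfl
  refine ⟨f.extendOfNorm e, fun x v => ?_⟩
  have := LinearMap.extendOfNorm_eq hdense ⟨1, hnorm⟩ (Finsupp.single (x, v) 1)
  simpa [e, f] using this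

end ReproducingKernel

/-! ### A criterion for positivity of a kernel -/

section Positivity

variable {X H : Type*} [NormedAddCommGroup H] [InnerProductSpace ℂ H]

/-- The value at `y` of the function defined by a finitely supported family of vectors. -/
def kernelSum (K : Matrix X X (H →L[ℂ] H)) (y : X) : (X →₀ H) →ₗ[ℂ] H :=
  Finsupp.lsum ℂ fun x => (K y x : H →ₗ[ℂ] H)

/-- The sesquilinear form of an operator-valued kernel. -/
def kernelForm (K : Matrix X X (H →L[ℂ] H)) (ξ η : X →₀ H) : ℂ :=
  η.sum fun y w => inner ℂ (kernelSum K y ξ) w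

variable {K : Matrix X X (H →L[ℂ] H)}

theorem kernelSum_single (y x : X) (w : H) : kernelSum K y (Finsupp.single x w) = K y x w := by
  simp [kernelSum]

theorem kernelForm_single (ξ : X →₀ H) (p : X) (k : H) :
    kernelForm K ξ (Finsupp.single p k) = inner ℂ (kernelSum K p ξ) k := by
  simp [kernelForm]

theorem kernelForm_sub_right (ξ η ζ : X →₀ H) :
    kernelForm K ξ (η - ζ) = kernelForm K ξ η - kernelForm K ξ ζ := by
  unfold kernelForm
  rw [Finsupp.sum_sub_index]
  intro a b c
  rw [inner_sub_right]

theorem kernelForm_sub_left (ξ η ζ : X →₀ H) :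
    kernelForm K (ξ - η) ζ = kernelForm K ξ ζ - kernelForm K η ζ := by
  simp only [kernelForm, map_sub, inner_sub_left, Finsupp.sum_sub]

variable [CompleteSpace H]

theorem single_kernelForm (hK : ∀ x y, star (K x y) = K y x) (p : X) (k : H) (η : X →₀ H) :
    kernelForm K (Finsupp.single p k) η = inner ℂ k (kernelSum K p η) := by
  simp only [kernelForm, kernelSum_single]
  simp only [kernelSum, Finsupp.coe_lsum, Finsupp.inner_sum]
  refine Finsupp.sum_congr fun y _ => ?_
  rw [← hK p y, ContinuousLinearMap.star_eq_adjoint, ContinuousLinearMap.adjoint_inner_left]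
  rfl

/-- Successive projection: subtracting the component at p lowers the form by the squared norm of the
value at p and makes that value zero. By `hcomm`, values already made zero at other points remain
zero. -/
theorem exists_kernelSum_eq_zero (hK : ∀ x y, star (K x y) = K y x) (h1 : ∀ x, K x x = 1)
    (hcomm : ∀ p q s, K q p * K p s = K q p * K p q * K q s) (ξ : X →₀ H) (l : Finset X) :
    ∃ η : X →₀ H, (kernelForm K η η).re ≤ (kernelForm K ξ ξ).re ∧
      (∀ y, y ∉ l → ξ y = 0 → η y = 0) ∧ ∀ p ∈ l, kernelSum K p η = 0 := by
  classical
  have hcomm' : ∀ p q (η : X →₀ H),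
      K q p (kernelSum K p η) = K q p (K p q (kernelSum K q η)) := by
    intro p q η
    simp only [kernelSum, Finsupp.coe_lsum, map_finsuppSum]
    refine Finsupp.sum_congr fun s _ => ?_
    exact DFunLike.congr_fun (hcomm p q s) (η s)
  induction l using Finset.induction_on with
  | empty => exact ⟨ξ, le_rfl, fun _ _ h => h, by simp⟩
  | insert p l hp ih =>
    obtain ⟨η, hle, hsupp, hzero⟩ := ih
    refine ⟨η - Finsupp.single p (kernelSum K p η), le_trans ?_ hle, ?_, ?_⟩
    · rw [kernelForm_sub_right, kernelForm_sub_left, kernelForm_sub_left, kernelForm_single,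
        single_kernelForm hK, single_kernelForm hK, kernelSum_single, h1]
      simp only [one_apply_eq_self, sub_self, sub_zero, Complex.sub_re]
      have := @inner_self_nonneg ℂ _ _ _ _ (kernelSum K p η)
      simp only [RCLike.re_to_complex] at this
      linarith
    · intro y hy h0
      rw [Finset.mem_insert, not_or] at hy
      simp [hsupp y hy.2 h0, Ne.symm hy.1]
    · intro q hq
      rw [map_sub, kernelSum_single]
      rcases Finset.mem_insert.1 hq with rfl | hq
      · simp [h1]
      · rw [hcomm', hzero q hq]
        simp

open scoped ComplexOrder in
/-- If the kernel functions of a Hermitian kernel span commuting projections, then the kernel is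
positive semidefinite. -/
theorem posSemidef_of_comm (hK : ∀ x y, star (K x y) = K y x) (h1 : ∀ x, K x x = 1)
    (hcomm : ∀ p q s, K q p * K p s = K q p * K p q * K q s) : K.PosSemidef := by
  have hH : K.IsHermitian := Matrix.IsHermitian.ext fun x y => hK y x
  refine ((RKHS.posSemidef_tfae (K := K)).out 0 2).2 (And.intro hH fun ξ => ?_)
  obtain ⟨η, hle, hsupp, hzero⟩ := exists_kernelSum_eq_zero hK h1 hcomm ξ ξ.support
  -- The corrected family is supported where its kernel sums vanish, so its form is zero; this
  -- bounds the form of ξ from below.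
  have h0 : kernelForm K η η = 0 := by
    refine Finset.sum_eq_zero fun y hy => ?_
    have hy' : y ∈ ξ.support := by
      by_contra h
      exact (Finsupp.mem_support_iff.1 hy) (hsupp y h (Finsupp.notMem_support_iff.1 h))
    simp [hzero y hy']
  rw [h0, Complex.zero_re] at hle
  rw [Finsupp.sum_comm]
  simp only [kernelForm, kernelSum, Finsupp.coe_lsum, Finsupp.sum_inner] at hle
  exact hle

end Positivity

/-! ### Least common right multiples -/

/-- `r` is a least common right multiple of `p` and `q`. -/
def IsRightLcm {P : Type*} [Monoid P] (p q r : P) : Prop :=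
  ∀ z, (p ∣ z ∧ q ∣ z) ↔ r ∣ z

theorem mem_lcmSet_iff {P : Type*} [Monoid P] {p q r : P} :
    r ∈ lcmSet p q ↔ IsRightLcm p q r := by
  simp only [lcmSet, Set.mem_ofPred_eq, Set.ext_iff]
  rfl

theorem inter_eq_empty_iff {P : Type*} [Monoid P] {p q : P} :
    principalRightIdeal p ∩ principalRightIdeal q = ∅ ↔ ∀ z, p ∣ z → ¬ q ∣ z := by
  simp only [Set.eq_empty_iff_forall_notMem, Set.mem_inter_iff, not_and]
  rfl

section Lcm

variable {P : Type*} [Monoid P]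

theorem IsRightLcm.symm {p q r : P} (h : IsRightLcm p q r) : IsRightLcm q p r :=
  fun z => and_comm.trans (h z)

theorem IsRightLcm.dvd_left {p q r : P} (h : IsRightLcm p q r) : p ∣ r :=
  ((h r).2 dvd_rfl).1

theorem IsRightLcm.dvd_right {p q r : P} (h : IsRightLcm p q r) : q ∣ r :=
  ((h r).2 dvd_rfl).2

theorem isRightLcm_self (p : P) : IsRightLcm p p p := fun _ => and_self_iff

theorem isRightLcm_one_right (p : P) : IsRightLcm p 1 p :=
  fun _ => and_iff_left (one_dvd _)

variable [IsLeftCancelMul P]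

theorem mul_dvd_mul_iff_left_cancel {s p q : P} : s * p ∣ s * q ↔ p ∣ q :=
  ⟨fun ⟨c, hc⟩ => ⟨c, mul_left_cancel (hc.trans (mul_assoc _ _ _))⟩, fun h => mul_dvd_mul_left s h⟩

theorem isRightLcm_mul_left {s p q r : P} :
    IsRightLcm (s * p) (s * q) (s * r) ↔ IsRightLcm p q r := by
  constructor
  · intro h z
    simpa only [mul_dvd_mul_iff_left_cancel] using h (s * z)
  · intro h z
    constructor
    · rintro ⟨h1, h2⟩
      obtain ⟨c, rfl⟩ := h1
      rw [mul_assoc] at h2 ⊢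
      rw [mul_dvd_mul_iff_left_cancel] at h2 ⊢
      exact (h _).1 ⟨Dvd.intro _ rfl, h2⟩
    · intro hr
      exact ⟨(mul_dvd_mul_left s h.dvd_left).trans hr, (mul_dvd_mul_left s h.dvd_right).trans hr⟩

theorem exists_unit_of_dvd_dvd {r r' : P} (h : r ∣ r') (h' : r' ∣ r) :
    ∃ u : Pˣ, r' = r * u := by
  obtain ⟨c, hc⟩ := h
  obtain ⟨d, hd⟩ := h'
  have h1 : c * d = 1 := mul_left_cancel (a := r) (by rw [← mul_assoc, ← hc, ← hd, mul_one])
  have h2 : d * c = 1 := mul_left_cancel (a := r') (by rw [← mul_assoc, ← hd, ← hc, mul_one])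
  exact ⟨⟨c, d, h1, h2⟩, hc⟩

/-- Two least common multiples differ by a unit. -/
theorem IsRightLcm.exists_unit {p q r r' : P} (h : IsRightLcm p q r) (h' : IsRightLcm p q r') :
    ∃ u : Pˣ, r' = r * u :=
  exists_unit_of_dvd_dvd ((h r').1 ((h' r').2 dvd_rfl)) ((h' r).1 ((h r).2 dvd_rfl))

end Lcm

/-! ### Extension by zero and its kernel -/

/-- A Nica-covariant isometric representation of a submonoid `S`, extended by zero to the ambient
monoid. -/
structure IsExtendedNica {P A : Type*} [Monoid P] [Semiring A] [StarRing A] (S : Submonoid P)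
    (T : P →* A) : Prop where
  isometric : ∀ x ∈ S, star (T x) * T x = 1
  map_eq_zero : ∀ x, x ∉ S → T x = 0
  covariant : ∀ x ∈ S, ∀ y ∈ S, ∀ c d, x * c = y * d → IsRightLcm x y (x * c) →
    star (T x) * T y = T c * star (T d)
  orthogonal : ∀ x ∈ S, ∀ y ∈ S, (∀ z, x ∣ z → ¬ y ∣ z) → star (T x) * T y = 0

/-- The kernel on `P` whose value at `(q, p)` is `T_b T_a^*` when `q b = p a` is a least common
multiple of `q` and `p`, and `0` when there is none. -/
def lcmKernel {P A : Type*} [Monoid P] [Semiring A] [StarRing A] (T : P →* A) : Matrix P P A :=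
  open scoped Classical in
  fun q p => if h : ∃ c : P × P, q * c.2 = p * c.1 ∧ IsRightLcm q p (q * c.2) then
    T h.choose.2 * star (T h.choose.1) else 0

section Kernel

variable {P A : Type*} [Monoid P] [Semiring A] [StarRing A]
  {S : Submonoid P} {T : P →* A}

theorem lcmKernel_eq_zero {q p : P} (h : ∀ z, q ∣ z → ¬ p ∣ z) : lcmKernel T q p = 0 := by
  rw [lcmKernel, dif_neg]
  rintro ⟨c, -, hc⟩
  exact h _ hc.dvd_left hc.dvd_right

theorem exists_lcm_or (hlcm : ∀ p q z : P, p ∣ z → q ∣ z → ∃ r, IsRightLcm p q r) (q p : P) :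
    (∀ z, q ∣ z → ¬ p ∣ z) ∨ ∃ a b, q * b = p * a ∧ IsRightLcm q p (q * b) := by
  by_cases h : ∃ z, q ∣ z ∧ p ∣ z
  · obtain ⟨z, hz1, hz2⟩ := h
    obtain ⟨r, hr⟩ := hlcm q p z hz1 hz2
    obtain ⟨b, rfl⟩ := hr.dvd_left
    obtain ⟨a, ha⟩ := hr.dvd_right
    exact .inr ⟨a, b, ha, hr⟩
  · exact .inl fun z h1 h2 => h ⟨z, h1, h2⟩

theorem IsExtendedNica.map_unit_mul_star (hT : IsExtendedNica S T)
    (hfact : ClosedUnderFactorization S) (u : Pˣ) : T u * star (T u) = 1 := by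
  have hu : (u : P) ∈ S := (hfact u ↑u⁻¹ (by simp [S.one_mem])).1
  have h1 : T u * T ↑u⁻¹ = 1 := by rw [← map_mul]; simp
  have h2 : star (T u) = T ↑u⁻¹ := by
    calc star (T u) = star (T u) * (T u * T ↑u⁻¹) := by rw [h1, mul_one]
      _ = T ↑u⁻¹ := by rw [← mul_assoc, hT.isometric _ hu, one_mul]
  rw [h2, h1]

variable [IsLeftCancelMul P]

/-- The choice of least common multiple is immaterial: two of them differ by a unit u on the right,
units lie in S by closure under factorization, and T_u T_u^* = 1. -/
theorem lcmKernel_eq (hT : IsExtendedNica S T) (hfact : ClosedUnderFactorization S) {q p a b : P}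
    (h : q * b = p * a) (hr : IsRightLcm q p (q * b)) :
    lcmKernel T q p = T b * star (T a) := by
  have hex : ∃ c : P × P, q * c.2 = p * c.1 ∧ IsRightLcm q p (q * c.2) := ⟨(a, b), h, hr⟩
  rw [lcmKernel, dif_pos hex]
  obtain ⟨h1, h2⟩ := hex.choose_spec
  generalize hex.choose = c at h1 h2
  obtain ⟨u, hu⟩ := hr.exists_unit h2
  have hb : c.2 = b * u := mul_left_cancel (a := q) (by rw [hu, mul_assoc])
  have ha : c.1 = a * u := mul_left_cancel (a := p) (by rw [← h1, hu, h, mul_assoc])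
  rw [hb, ha, map_mul, map_mul, star_mul, mul_assoc, ← mul_assoc (T u),
    hT.map_unit_mul_star hfact, one_mul]

theorem lcmKernel_self (hT : IsExtendedNica S T) (hfact : ClosedUnderFactorization S) (p : P) :
    lcmKernel T p p = 1 := by
  rw [lcmKernel_eq hT hfact (q := p) (p := p) (a := 1) (b := 1) rfl
    (by rw [mul_one]; exact isRightLcm_self p)]
  simp

theorem star_lcmKernel (hT : IsExtendedNica S T) (hfact : ClosedUnderFactorization S)
    (hlcm : ∀ p q z : P, p ∣ z → q ∣ z → ∃ r, IsRightLcm p q r) (q p : P) :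
    star (lcmKernel T q p) = lcmKernel T p q := by
  rcases exists_lcm_or hlcm q p with h | ⟨a, b, h, hr⟩
  · rw [lcmKernel_eq_zero h, lcmKernel_eq_zero fun z h1 h2 => h z h2 h1, star_zero]
  · rw [lcmKernel_eq hT hfact h hr, lcmKernel_eq hT hfact h.symm (h ▸ hr.symm), star_mul, star_star]

/-- By left cancellation, least common multiples commute with left multiplication and the cofactors
are unchanged. This invariance is what makes left translation isometric. -/
theorem lcmKernel_mul_left (hT : IsExtendedNica S T) (hfact : ClosedUnderFactorization S)
    (hlcm : ∀ p q z : P, p ∣ z → q ∣ z → ∃ r, IsRightLcm p q r) (s q p : P) :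
    lcmKernel T (s * q) (s * p) = lcmKernel T q p := by
  rcases exists_lcm_or hlcm q p with h | ⟨a, b, h, hr⟩
  · rw [lcmKernel_eq_zero h, lcmKernel_eq_zero]
    rintro z ⟨c, rfl⟩ h2
    rw [mul_assoc, mul_dvd_mul_iff_left_cancel] at h2
    exact h _ (Dvd.intro _ rfl) h2
  · rw [lcmKernel_eq hT hfact h hr, lcmKernel_eq hT hfact (a := a) (b := b)]
    · rw [mul_assoc, mul_assoc, h]
    · rw [mul_assoc]
      exact isRightLcm_mul_left.2 hr

/-- Translation in one variable by an element of the submonoid. -/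
theorem lcmKernel_mul_right (hT : IsExtendedNica S T) (hfact : ClosedUnderFactorization S)
    (hlcm : ∀ p q z : P, p ∣ z → q ∣ z → ∃ r, IsRightLcm p q r) (q p : P) {s : P} (hs : s ∈ S) :
    lcmKernel T q (p * s) = lcmKernel T q p * T s := by
  rcases exists_lcm_or hlcm q p with h | ⟨a, b, h, hr⟩
  · rw [lcmKernel_eq_zero h, lcmKernel_eq_zero, zero_mul]
    exact fun z h1 h2 => h z h1 ((Dvd.intro _ rfl).trans h2)
  rw [lcmKernel_eq hT hfact h hr]
  -- The cofactor a divides every w for which q divides pw, so it reduces the common multiples of q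
  -- and ps to those of a and s.
  have hdvd : ∀ z, q ∣ p * s * z → a ∣ s * z := by
    intro z hz
    rw [mul_assoc] at hz
    have := (hr _).1 ⟨hz, Dvd.intro _ rfl⟩
    rwa [h, mul_dvd_mul_iff_left_cancel] at this
  by_cases ha : a ∈ S
  · rw [mul_assoc]
    rcases exists_lcm_or hlcm a s with h' | ⟨d, c, h', hr'⟩
    · rw [hT.orthogonal a ha s hs h', mul_zero, lcmKernel_eq_zero]
      rintro z h1 ⟨e, rfl⟩
      exact h' _ (hdvd e h1) (Dvd.intro _ rfl)
    · rw [hT.covariant a ha s hs c d h' hr', lcmKernel_eq hT hfact (a := d) (b := b * c),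
        map_mul, mul_assoc]
      · rw [← mul_assoc, h, mul_assoc, h', mul_assoc]
      · intro z
        constructor
        · rintro ⟨h1, e, rfl⟩
          rw [← mul_assoc, h, mul_assoc, mul_assoc, mul_dvd_mul_iff_left_cancel]
          rw [← hr']
          exact ⟨hdvd e h1, Dvd.intro _ rfl⟩
        · intro hz
          refine ⟨(Dvd.intro _ rfl).trans hz, dvd_trans ?_ hz⟩
          rw [← mul_assoc, h, mul_assoc, h', ← mul_assoc]
          exact Dvd.intro _ rfl
  -- The right side vanishes since T_a = 0. On the left, a divides sd; were the new cofactor d in S,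
  -- then so would be sd and hence a.
  · rw [hT.map_eq_zero a ha, star_zero, mul_zero, zero_mul]
    rcases exists_lcm_or hlcm q (p * s) with h' | ⟨d, c, h', hr'⟩
    · rw [lcmKernel_eq_zero h']
    · rw [lcmKernel_eq hT hfact h' hr']
      have hd : d ∉ S := by
        intro hd
        obtain ⟨e, he⟩ := hdvd d (h' ▸ hr'.dvd_left)
        exact ha (hfact a e (he ▸ S.mul_mem hs hd)).1
      rw [hT.map_eq_zero d hd, star_zero, mul_zero]

/-- Translation by an arbitrary element can be moved to the other variable. -/
theorem lcmKernel_mul_left_eq (hT : IsExtendedNica S T) (hfact : ClosedUnderFactorization S)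
    (hlcm : ∀ p q z : P, p ∣ z → q ∣ z → ∃ r, IsRightLcm p q r) {x p c d : P}
    (h : x * c = p * d) (hr : IsRightLcm x p (x * c)) (q : P) :
    lcmKernel T (x * q) p = lcmKernel T q c * star (T d) := by
  -- Multiplying by x identifies the common multiples of q and c with those of xq and p, since xc is
  -- a least common multiple of x and p.
  have hiff : ∀ z, (q ∣ z ∧ c ∣ z) ↔ (x * q ∣ x * z ∧ p ∣ x * z) := by
    intro z
    rw [mul_dvd_mul_iff_left_cancel, ← mul_dvd_mul_iff_left_cancel (s := x) (p := c), ← hr]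
    simp
  rcases exists_lcm_or hlcm q c with h' | ⟨a, b, h', hr'⟩
  · rw [lcmKernel_eq_zero h', zero_mul, lcmKernel_eq_zero]
    rintro z ⟨e, rfl⟩ h2
    rw [mul_assoc] at h2
    have := (hiff (q * e)).2 ⟨mul_dvd_mul_left _ (Dvd.intro _ rfl), h2⟩
    exact h' _ this.1 this.2
  · rw [lcmKernel_eq hT hfact h' hr', lcmKernel_eq hT hfact (a := d * a) (b := b), map_mul,
      star_mul, mul_assoc]
    · rw [mul_assoc, h', ← mul_assoc, h, mul_assoc]
    · intro z
      constructor
      · rintro ⟨⟨e, rfl⟩, h2⟩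
        rw [mul_assoc] at h2
        rw [mul_assoc, mul_assoc, mul_dvd_mul_iff_left_cancel, ← hr']
        exact (hiff (q * e)).2 ⟨mul_dvd_mul_left _ (Dvd.intro _ rfl), h2⟩
      · intro hz
        have := (hiff (q * b)).1 ((hr' _).2 dvd_rfl)
        rw [← mul_assoc] at this
        exact ⟨this.1.trans hz, this.2.trans hz⟩

/-- If a or b is outside S then K(q,p) = T_b T_a^* is zero. Otherwise T_a^* K(p,s) = K(pa,s) =
K(qb,s) = T_b^* K(q,s), while K(q,p)K(p,q) = T_b T_b^* because T_a is isometric. -/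
theorem lcmKernel_comm (hT : IsExtendedNica S T) (hfact : ClosedUnderFactorization S)
    (hlcm : ∀ p q z : P, p ∣ z → q ∣ z → ∃ r, IsRightLcm p q r) (p q s : P) :
    lcmKernel T q p * lcmKernel T p s
      = lcmKernel T q p * lcmKernel T p q * lcmKernel T q s := by
  have hR := fun q p {s} hs => lcmKernel_mul_right hT hfact hlcm q p (s := s) hs
  have hL : ∀ q p {s}, s ∈ S → lcmKernel T (p * s) q = star (T s) * lcmKernel T p q := by
    intro q p s hs
    rw [← star_lcmKernel hT hfact hlcm, hR q p hs, star_mul, star_lcmKernel hT hfact hlcm]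
  rcases exists_lcm_or hlcm q p with h | ⟨a, b, h, hr⟩
  · rw [lcmKernel_eq_zero h, zero_mul, zero_mul, zero_mul]
  · have hqp := lcmKernel_eq hT hfact h hr
    have hpq := lcmKernel_eq hT hfact h.symm (h ▸ hr.symm)
    by_cases hab : a ∈ S ∧ b ∈ S
    · calc lcmKernel T q p * lcmKernel T p s = T b * lcmKernel T (q * b) s := by
            rw [hqp, h, hL s p hab.1, mul_assoc]
        _ = T b * (star (T a) * T a) * star (T b) * lcmKernel T q s := by
            rw [hT.isometric a hab.1, hL s q hab.2, mul_one, mul_assoc]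
        _ = lcmKernel T q p * lcmKernel T p q * lcmKernel T q s := by
            rw [hqp, hpq]; simp only [mul_assoc]
    · have : lcmKernel T q p = 0 := by
        rw [hqp]
        by_cases ha : a ∈ S
        · rw [hT.map_eq_zero b fun hb => hab ⟨ha, hb⟩, zero_mul]
        · rw [hT.map_eq_zero a ha, star_zero, mul_zero]
      rw [this, zero_mul, zero_mul, zero_mul]

end Kernel

/-! ### The dilation of an extension by zero -/

section Dilation

variable {P H E : Type*} [Monoid P] [NormedAddCommGroup H]
  [InnerProductSpace ℂ H] [CompleteSpace H] [NormedAddCommGroup E] [InnerProductSpace ℂ E]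
  [CompleteSpace E] [RKHS ℂ E P H] {S : Submonoid P} {T : P →* (H →L[ℂ] H)}

/-- Pairing with kernel functions shows that the adjoint of translation by x is composition with
left multiplication by x. Adjoints can thus be computed pointwise from the kernel. -/
theorem star_translation_apply {W : E →L[ℂ] E} {x : P}
    (hW : ∀ p v, W (RKHS.kerFun E p v) = RKHS.kerFun E (x * p) v) (f : E) (q : P) :
    (star W f) q = f (x * q) := by
  refine ext_inner_left ℂ fun v => ?_
  rw [← RKHS.kerFun_inner, ContinuousLinearMap.star_eq_adjoint,
    ContinuousLinearMap.adjoint_inner_right, hW, RKHS.kerFun_inner]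

theorem star_translation_kerFun_eq_zero (hE : RKHS.kernel E = lcmKernel T) {W : E →L[ℂ] E} {x : P}
    (hW : ∀ p v, W (RKHS.kerFun E p v) = RKHS.kerFun E (x * p) v) {p : P}
    (h : ∀ z, x ∣ z → ¬ p ∣ z) (v : H) :
    star W (RKHS.kerFun E p v) = 0 := by
  refine DFunLike.ext _ _ fun q => ?_
  rw [star_translation_apply hW, RKHS.kerFun_apply, hE,
    lcmKernel_eq_zero fun z hz => h z ((Dvd.intro _ rfl).trans hz)]
  simp

variable [IsLeftCancelMul P]

theorem star_translation_kerFun (hT : IsExtendedNica S T) (hfact : ClosedUnderFactorization S)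
    (hlcm : ∀ p q z : P, p ∣ z → q ∣ z → ∃ r, IsRightLcm p q r)
    (hE : RKHS.kernel E = lcmKernel T) {W : E →L[ℂ] E} {x : P}
    (hW : ∀ p v, W (RKHS.kerFun E p v) = RKHS.kerFun E (x * p) v) {p c d : P}
    (h : x * c = p * d) (hr : IsRightLcm x p (x * c)) (v : H) :
    star W (RKHS.kerFun E p v) = RKHS.kerFun E c (star (T d) v) := by
  refine DFunLike.ext _ _ fun q => ?_
  rw [star_translation_apply hW, RKHS.kerFun_apply, RKHS.kerFun_apply, hE,
    lcmKernel_mul_left_eq hT hfact hlcm h hr]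
  rfl

theorem exists_nica_on_rkhs (hT : IsExtendedNica S T) (hfact : ClosedUnderFactorization S)
    (hlcm : ∀ p q z : P, p ∣ z → q ∣ z → ∃ r, IsRightLcm p q r)
    (hE : RKHS.kernel E = lcmKernel T) :
    ∃ W : P →* (E →L[ℂ] E), IsNicaCovariant W ∧
      ∀ x p v, W x (RKHS.kerFun E p v) = RKHS.kerFun E (x * p) v := by
  have hex : ∀ x : P, ∃ W : E →L[ℂ] E, ∀ p v,
      W (RKHS.kerFun E p v) = RKHS.kerFun E (x * p) v := fun x =>
    exists_translation (fun p => x * p) fun p q => by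
      rw [hE, lcmKernel_mul_left hT hfact hlcm]
  choose W hW using hex
  have hstar := fun x {p c d} h hr v =>
    star_translation_kerFun (p := p) (c := c) (d := d) hT hfact hlcm hE (hW x) h hr v
  have hstar0 := fun x {p} h v => star_translation_kerFun_eq_zero (p := p) hE (hW x) h v
  have hiso : ∀ x, star (W x) * W x = 1 := by
    refine fun x => clm_ext_kerFun fun p v => ?_
    rw [mul_apply_eq_comp, hW, hstar x (c := p) (d := 1) (by rw [mul_one])
      fun z => ⟨fun h => h.2, fun h => ⟨(Dvd.intro _ rfl).trans h, h⟩⟩]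
    simp
  have hmul : ∀ x y, W (x * y) = W x * W y := by
    refine fun x y => clm_ext_kerFun fun p v => ?_
    rw [mul_apply_eq_comp, hW, hW, hW, mul_assoc]
  have hcov : ∀ x y a b, x * a = y * b → IsRightLcm x y (x * a) →
      star (W x) * W y = W a * star (W b) := by
    refine fun x y a b h hr => clm_ext_kerFun fun p v => ?_
    rw [mul_apply_eq_comp, mul_apply_eq_comp, hW]
    -- Common multiples of x and yp become common multiples of b and p after cancelling y, so both
    -- sides of the covariance relation send a kernel function to the same one, or both to zero.
    have hiff : ∀ z, (x ∣ y * z ∧ y * p ∣ y * z) ↔ (b ∣ z ∧ p ∣ z) := by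
      intro z
      rw [mul_dvd_mul_iff_left_cancel, ← mul_dvd_mul_iff_left_cancel (s := y) (p := b), ← h, ← hr]
      simp
    rcases exists_lcm_or hlcm b p with h' | ⟨d, c, h', hr'⟩
    · rw [hstar0 b h', map_zero, hstar0 x]
      rintro z h1 ⟨e, rfl⟩
      rw [mul_assoc] at h1
      have := (hiff (p * e)).1 ⟨h1, mul_dvd_mul_left _ (Dvd.intro _ rfl)⟩
      exact h' _ this.1 this.2
    · rw [hstar b h' hr', hW, hstar x (c := a * c) (d := d)]
      · rw [← mul_assoc, h, mul_assoc, h', mul_assoc]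
      · rw [← mul_assoc, h, mul_assoc]
        intro z
        constructor
        · rintro ⟨h1, e, rfl⟩
          rw [mul_assoc] at h1 ⊢
          rw [mul_dvd_mul_iff_left_cancel, ← hr']
          exact (hiff (p * e)).1 ⟨h1, mul_dvd_mul_left _ (Dvd.intro _ rfl)⟩
        · intro hz
          have := (hiff (b * c)).2 ((hr' _).2 dvd_rfl)
          exact ⟨this.1.trans hz, this.2.trans hz⟩
  refine ⟨{ toFun := W, map_one' := clm_ext_kerFun fun p v => ?_, map_mul' := hmul },
    ⟨hiso, fun x y r hr => ?_, fun x y hxy => ?_⟩, hW⟩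
  · rw [hW]; simp
  · rw [mem_lcmSet_iff] at hr
    obtain ⟨a, rfl⟩ := hr.dvd_left
    obtain ⟨b, hb⟩ := hr.dvd_right
    change W x * star (W x) * (W y * star (W y)) = W (x * a) * star (W (x * a))
    calc W x * star (W x) * (W y * star (W y))
        = W x * (star (W x) * W y) * star (W y) := by simp only [mul_assoc]
      _ = W (x * a) * star (W (y * b)) := by
          rw [hcov x y a b hb hr, hmul x a, hmul y b, star_mul]; simp only [mul_assoc]
      _ = _ := by rw [hb]
  · have hno : ∀ z, x ∣ z → ¬ y ∣ z := by
      intro z h1 h2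
      obtain ⟨r, hr⟩ := hlcm x y z h1 h2
      rw [← mem_lcmSet_iff, hxy] at hr
      exact hr
    have h0 : star (W x) * W y = 0 := by
      refine clm_ext_kerFun fun p v => ?_
      rw [mul_apply_eq_comp, hW,
        hstar0 x fun z h1 h2 => hno z h1 ((Dvd.intro _ rfl).trans h2)]
      simp
    change W x * star (W x) * (W y * star (W y)) = 0
    calc W x * star (W x) * (W y * star (W y))
        = W x * (star (W x) * W y) * star (W y) := by simp only [mul_assoc]
      _ = 0 := by rw [h0, mul_zero, zero_mul]

/-- The right translation law of the kernel at p = 1 keeps the copy of H at the identity invariant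
under S, where the dilation acts as T. -/
theorem translation_kerFun_one (hT : IsExtendedNica S T) (hfact : ClosedUnderFactorization S)
    (hlcm : ∀ p q z : P, p ∣ z → q ∣ z → ∃ r, IsRightLcm p q r)
    (hE : RKHS.kernel E = lcmKernel T) {s : P} (hs : s ∈ S) (v : H) :
    RKHS.kerFun E s v = RKHS.kerFun E 1 (T s v) := by
  refine DFunLike.ext _ _ fun q => ?_
  have := lcmKernel_mul_right hT hfact hlcm q 1 hs
  rw [one_mul] at this
  rw [RKHS.kerFun_apply, RKHS.kerFun_apply, hE, this]
  rfl

end Dilation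

/-- The Hilbert space, representation and intertwining isometry of the dilation. -/
theorem exists_dilation {P H : Type u} [Monoid P] [IsLeftCancelMul P] [NormedAddCommGroup H]
    [InnerProductSpace ℂ H] [CompleteSpace H] {S : Submonoid P} {T : P →* (H →L[ℂ] H)}
    (hT : IsExtendedNica S T) (hfact : ClosedUnderFactorization S)
    (hlcm : ∀ p q z : P, p ∣ z → q ∣ z → ∃ r, IsRightLcm p q r) :
    ∃ (E : Type u) (_ : NormedAddCommGroup E) (_ : InnerProductSpace ℂ E) (_ : CompleteSpace E)
      (W : P →* (E →L[ℂ] E)) (j : H →L[ℂ] E), IsNicaCovariant W ∧ Function.Injective j ∧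
      ∀ s ∈ S, W s ∘L j = j ∘L T s ∧ star (W s) ∘L j = j ∘L star (T s) := by
  have : Fact (lcmKernel T).PosSemidef := ⟨posSemidef_of_comm
    (star_lcmKernel hT hfact hlcm) (lcmKernel_self hT hfact) (lcmKernel_comm hT hfact hlcm)⟩
  have hE : RKHS.kernel (RKHS.OfKernel (lcmKernel T)) = lcmKernel T := RKHS.OfKernel.kernel_ofKernel
  obtain ⟨W, hW, hWk⟩ := exists_nica_on_rkhs hT hfact hlcm hE
  -- The new space stays in the universe of P and H, so W lifts to the full C*-algebra. Evaluation
  -- at 1 will show that the embedding is injective.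
  refine ⟨RKHS.OfKernel (lcmKernel T), inferInstance, inferInstance, inferInstance, W,
    RKHS.kerFun (RKHS.OfKernel (lcmKernel T)) 1, hW, ?_, fun s hs => ⟨?_, ?_⟩⟩
  · intro v w hvw
    have h := congrArg (fun f : RKHS.OfKernel (lcmKernel T) => f (1 : P)) hvw
    simpa only [RKHS.kerFun_apply, hE, lcmKernel_self hT hfact, one_apply_eq_self] using h
  · ext1 v
    change W s (RKHS.kerFun _ 1 v) = RKHS.kerFun _ 1 (T s v)
    rw [hWk, mul_one, translation_kerFun_one hT hfact hlcm hE hs]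
  · ext1 v
    exact star_translation_kerFun hT hfact hlcm hE (hWk s) (p := 1) (c := 1) (d := s)
      (by simp) (by rw [mul_one]; exact isRightLcm_one_right s) v

/-! ### Submonoids closed under factorization -/

theorem IsRightLCM.isLeftCancelMul {P : Type*} [Monoid P] (hP : IsRightLCM P) :
    IsLeftCancelMul P :=
  ⟨fun p _ _ h => hP.left_cancel p _ _ h⟩

theorem IsRightLCM.exists_isRightLcm {P : Type*} [Monoid P] (hP : IsRightLCM P) (p q z : P)
    (hp : p ∣ z) (hq : q ∣ z) : ∃ r, IsRightLcm p q r := by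
  rcases hP.inter_eq p q with h | ⟨r, hr⟩
  · exact absurd hq (inter_eq_empty_iff.1 h z hp)
  · exact ⟨r, mem_lcmSet_iff.1 hr⟩

theorem lcmSet_eq_empty_iff {P : Type*} [Monoid P]
    (hlcm : ∀ p q z : P, p ∣ z → q ∣ z → ∃ r, IsRightLcm p q r) {p q : P} :
    lcmSet p q = ∅ ↔ ∀ z, p ∣ z → ¬ q ∣ z := by
  simp only [Set.eq_empty_iff_forall_notMem, mem_lcmSet_iff]
  refine ⟨fun h z h1 h2 => ?_, fun h r hr => h r hr.dvd_left hr.dvd_right⟩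
  obtain ⟨r, hr⟩ := hlcm p q z h1 h2
  exact h r hr

section Submonoid

variable {P : Type*} [Monoid P] {S : Submonoid P}

theorem ClosedUnderFactorization.mem_of_dvd (hfact : ClosedUnderFactorization S) {x y : P}
    (h : x ∣ y) (hy : y ∈ S) : x ∈ S := by
  obtain ⟨c, rfl⟩ := h
  exact (hfact x c hy).1

theorem ClosedUnderFactorization.coe_dvd_coe (hfact : ClosedUnderFactorization S) {x y : S} :
    (x : P) ∣ y ↔ x ∣ y := by
  constructor
  · rintro ⟨c, hc⟩
    exact ⟨⟨c, (hfact x c (hc ▸ y.2)).2⟩, Subtype.ext hc⟩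
  · rintro ⟨c, rfl⟩
    exact Dvd.intro _ rfl

theorem PreservesOrthogonality.forall_not_dvd_iff (horth : PreservesOrthogonality S) (x y : S) :
    (∀ z : S, x ∣ z → ¬ y ∣ z) ↔ ∀ z : P, (x : P) ∣ z → ¬ (y : P) ∣ z := by
  rw [← inter_eq_empty_iff, ← inter_eq_empty_iff]
  exact horth x y

/-- A common multiple in P forces one in S, by preservation of orthogonality; r divides the latter,
so closure under factorization puts r in S. -/
theorem IsRightLcm.mem_submonoid (hfact : ClosedUnderFactorization S)
    (horth : PreservesOrthogonality S) {x y : S} {r : P} (h : IsRightLcm (x : P) y r) : r ∈ S := by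
  by_contra hr
  refine (horth.forall_not_dvd_iff x y).1 (fun z hx hy => hr ?_) r h.dvd_left h.dvd_right
  exact hfact.mem_of_dvd ((h z).1 ⟨hfact.coe_dvd_coe.2 hx, hfact.coe_dvd_coe.2 hy⟩) z.2

theorem isRightLcm_of_coe (hfact : ClosedUnderFactorization S) {x y r : S}
    (h : IsRightLcm (x : P) y r) : IsRightLcm x y r := by
  intro z
  rw [← hfact.coe_dvd_coe, ← hfact.coe_dvd_coe, ← hfact.coe_dvd_coe]
  exact h z

/-- The least common multiple t taken in P lies in S, so r and t divide each other. -/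
theorem IsRightLcm.coe (hfact : ClosedUnderFactorization S) (horth : PreservesOrthogonality S)
    (hlcm : ∀ p q z : P, p ∣ z → q ∣ z → ∃ r, IsRightLcm p q r) {x y r : S}
    (h : IsRightLcm x y r) : IsRightLcm (x : P) y r := by
  obtain ⟨t, ht⟩ := hlcm x y r (hfact.coe_dvd_coe.2 h.dvd_left) (hfact.coe_dvd_coe.2 h.dvd_right)
  lift t to S using ht.mem_submonoid hfact horth
  have h1 : (r : P) ∣ t := hfact.coe_dvd_coe.2
    ((h t).1 ⟨hfact.coe_dvd_coe.1 ht.dvd_left, hfact.coe_dvd_coe.1 ht.dvd_right⟩)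
  have h2 : (t : P) ∣ r := (ht r).1 ⟨hfact.coe_dvd_coe.2 h.dvd_left, hfact.coe_dvd_coe.2 h.dvd_right⟩
  exact fun z => (ht z).trans ⟨h1.trans, h2.trans⟩

theorem exists_isRightLcm_submonoid (hfact : ClosedUnderFactorization S)
    (horth : PreservesOrthogonality S)
    (hlcm : ∀ p q z : P, p ∣ z → q ∣ z → ∃ r, IsRightLcm p q r) (x y z : S) (hx : x ∣ z)
    (hy : y ∣ z) : ∃ r, IsRightLcm x y r := by
  obtain ⟨t, ht⟩ := hlcm x y z (hfact.coe_dvd_coe.2 hx) (hfact.coe_dvd_coe.2 hy)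
  lift t to S using ht.mem_submonoid hfact horth
  exact ⟨t, isRightLcm_of_coe hfact ht⟩

/-- The restriction of a Nica-covariant representation is Nica covariant. -/
theorem IsNicaCovariant.restrict {A : Type*} [Semiring A] [StarRing A]
    (hfact : ClosedUnderFactorization S) (horth : PreservesOrthogonality S)
    (hlcm : ∀ p q z : P, p ∣ z → q ∣ z → ∃ r, IsRightLcm p q r) {W : P →* A}
    (hW : IsNicaCovariant W) : IsNicaCovariant (W.comp S.subtype) where
  isometric x := hW.isometric x
  covariant x y r hr := hW.covariant x y r
    (mem_lcmSet_iff.2 ((mem_lcmSet_iff.1 hr).coe hfact horth hlcm))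
  orthogonal x y h := hW.orthogonal x y <| (lcmSet_eq_empty_iff hlcm).2 <|
    (horth.forall_not_dvd_iff x y).1 <|
      (lcmSet_eq_empty_iff (exists_isRightLcm_submonoid hfact horth hlcm)).1 h

open scoped Classical in
/-- The extension by zero of a representation of a submonoid closed under factorization. -/
def extendByZero {A : Type*} [Semiring A] (hfact : ClosedUnderFactorization S) (V : S →* A) :
    P →* A where
  toFun p := if h : p ∈ S then V ⟨p, h⟩ else 0
  map_one' := by rw [dif_pos S.one_mem]; exact map_one V
  map_mul' x y := by
    by_cases h : x * y ∈ S
    · rw [dif_pos h, dif_pos (hfact x y h).1, dif_pos (hfact x y h).2, ← map_mul]; rfl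
    · rw [dif_neg h]
      by_cases hx : x ∈ S
      · rw [dif_neg (c := y ∈ S) fun hy => h (S.mul_mem hx hy), mul_zero]
      · rw [dif_neg hx, zero_mul]

theorem extendByZero_coe {A : Type*} [Semiring A] (hfact : ClosedUnderFactorization S) (V : S →* A)
    (x : S) : extendByZero hfact V x = V x :=
  dif_pos x.2

/-- Multiplying the Nica relation by V_x^* on the left and V_y on the right cancels the isometries
and gives the form V_x^* V_y = V_c V_d^*. -/
theorem isExtendedNica_extendByZero {A : Type*} [Semiring A] [StarRing A]
    (hfact : ClosedUnderFactorization S) (horth : PreservesOrthogonality S)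
    (hlcm : ∀ p q z : P, p ∣ z → q ∣ z → ∃ r, IsRightLcm p q r) {V : S →* A}
    (hV : IsNicaCovariant V) : IsExtendedNica S (extendByZero hfact V) where
  isometric x hx := by
    lift x to S using hx
    rw [extendByZero_coe, hV.isometric]
  map_eq_zero x hx := dif_neg hx
  covariant x hx y hy c d h hr := by
    lift x to S using hx
    lift y to S using hy
    have hxc := hr.mem_submonoid hfact horth
    lift c to S using (hfact _ _ hxc).2
    lift d to S using (hfact _ _ (h ▸ hxc)).2
    have h' : x * c = y * d := Subtype.ext h
    have hr' : x * c ∈ lcmSet x y := mem_lcmSet_iff.2 (isRightLcm_of_coe hfact hr)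
    simp only [extendByZero_coe]
    calc star (V x) * V y
        = (star (V x) * V x) * star (V x) * V y * (star (V y) * V y) := by
          simp only [hV.isometric, one_mul, mul_one]
      _ = star (V x) * (V x * star (V x) * (V y * star (V y))) * V y := by simp only [mul_assoc]
      _ = star (V x) * (V (x * c) * star (V (y * d))) * V y := by
          rw [hV.covariant x y _ hr', h']
      _ = (star (V x) * V x) * V c * star (V d) * (star (V y) * V y) := by
          simp only [map_mul, star_mul, mul_assoc]
      _ = V c * star (V d) := by simp only [hV.isometric, one_mul, mul_one]
  orthogonal x hx y hy h := by
    lift x to S using hx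
    lift y to S using hy
    have h0 := hV.orthogonal x y <|
      (lcmSet_eq_empty_iff (exists_isRightLcm_submonoid hfact horth hlcm)).2
        ((horth.forall_not_dvd_iff x y).2 h)
    simp only [extendByZero_coe]
    calc star (V x) * V y
        = (star (V x) * V x) * star (V x) * V y * (star (V y) * V y) := by
          simp only [hV.isometric, one_mul, mul_one]
      _ = star (V x) * (V x * star (V x) * (V y * star (V y))) * V y := by simp only [mul_assoc]
      _ = 0 := by rw [h0, mul_zero, zero_mul]

end Submonoid

/-! ### The homomorphism `C*(S) → C*(P)` -/

/-- A closed *-subalgebra property that holds on the generators `univRep P p` holds on `C*(P)`. -/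
theorem FullCStar.mem_of_univRep_mem {P : Type u} [Monoid P] (B : StarSubalgebra ℂ (FullCStar P))
    (hB : IsClosed (B : Set (FullCStar P))) (h : ∀ p, univRep P p ∈ B) (a : FullCStar P) :
    a ∈ B := by
  have hle : generatedCStar (Set.range (univRep P)) ≤ B := by
    refine StarSubalgebra.topologicalClosure_minimal (StarAlgebra.adjoin_le ?_) hB
    rintro _ ⟨p, rfl⟩
    exact h p
  rw [generatedCStar_univRep] at hle
  exact hle StarSubalgebra.mem_top

theorem FullCStar.ext_eval {P : Type u} [Monoid P] {a b : FullCStar P}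
    (h : ∀ ρ : NicaRep P, ρ.eval a = ρ.eval b) : a = b :=
  Subtype.ext (lp.ext (funext h))

/-- If an operator intertwines two Nica-covariant representations together with their adjoints, then
it intertwines the induced representations of the full semigroup C*-algebra. -/
theorem FullCStar.intertwine {P : Type u} [Monoid P] {H E : Type*} [NormedAddCommGroup H]
    [InnerProductSpace ℂ H] [CompleteSpace H] [NormedAddCommGroup E] [InnerProductSpace ℂ E]
    [CompleteSpace E] (π : FullCStar P →⋆ₐ[ℂ] (H →L[ℂ] H)) (ψ : FullCStar P →⋆ₐ[ℂ] (E →L[ℂ] E))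
    (j : H →L[ℂ] E) (h : ∀ p, ψ (univRep P p) ∘L j = j ∘L π (univRep P p))
    (hs : ∀ p, star (ψ (univRep P p)) ∘L j = j ∘L star (π (univRep P p))) (a : FullCStar P) :
    ψ a ∘L j = j ∘L π a := by
  -- The condition is imposed on a and on its adjoint together, so that the set is closed under the
  -- involution.
  let B : StarSubalgebra ℂ (FullCStar P) :=
    { carrier := {a | ψ a ∘L j = j ∘L π a ∧ ψ (star a) ∘L j = j ∘L π (star a)}
      mul_mem' := by
        rintro a b ⟨ha, ha'⟩ ⟨hb, hb'⟩
        constructor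
        · rw [map_mul, map_mul, ContinuousLinearMap.mul_def, ContinuousLinearMap.mul_def,
            ContinuousLinearMap.comp_assoc, hb, ← ContinuousLinearMap.comp_assoc, ha,
            ContinuousLinearMap.comp_assoc]
        · rw [star_mul, map_mul, map_mul, ContinuousLinearMap.mul_def, ContinuousLinearMap.mul_def,
            ContinuousLinearMap.comp_assoc, ha', ← ContinuousLinearMap.comp_assoc, hb',
            ContinuousLinearMap.comp_assoc]
      add_mem' := by
        rintro a b ⟨ha, ha'⟩ ⟨hb, hb'⟩
        constructor
        · rw [map_add, map_add, ContinuousLinearMap.add_comp, ContinuousLinearMap.comp_add, ha, hb]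
        · rw [star_add, map_add, map_add, ContinuousLinearMap.add_comp,
            ContinuousLinearMap.comp_add, ha', hb']
      algebraMap_mem' := by
        intro r
        constructor
        · ext v
          simp [Algebra.algebraMap_eq_smul_one]
        · ext v
          simp [Algebra.algebraMap_eq_smul_one]
      star_mem' := by
        rintro a ⟨ha, ha'⟩
        exact ⟨ha', by rwa [star_star]⟩ }
  have hψ : Continuous ψ := map_continuous ψ
  have hπ : Continuous π := map_continuous π
  have hB : IsClosed (B : Set (FullCStar P)) := by
    refine IsClosed.inter (isClosed_eq ?_ ?_) (isClosed_eq ?_ ?_)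
    · exact hψ.clm_comp continuous_const
    · exact continuous_const.clm_comp hπ
    · exact (hψ.comp continuous_star).clm_comp continuous_const
    · exact continuous_const.clm_comp (hπ.comp continuous_star)
  exact (FullCStar.mem_of_univRep_mem B hB (fun p => ⟨h p, by rw [map_star, map_star, hs]⟩) a).1

section Restriction

variable {P : Type u} [Monoid P] {S : Submonoid P}

/-- The restriction of a Nica-covariant representation on a Hilbert space to a submonoid. -/
def NicaRep.restrict (ρ : NicaRep P) (h : IsNicaCovariant (ρ.V.comp S.subtype)) : NicaRep S where
  H := ρ.H
  V := ρ.V.comp S.subtype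
  isNicaCovariant := h

/-- The direct sum of all restrictions to `S` of representations of `P`. -/
def restrictProduct (h : ∀ ρ : NicaRep P, IsNicaCovariant (ρ.V.comp S.subtype)) :
    FullCStar S →⋆ₐ[ℂ] NicaProduct P where
  toFun a := ⟨fun ρ => (ρ.restrict (h ρ)).eval a, memℓp_infty
    ⟨‖a‖, by rintro _ ⟨ρ, rfl⟩; exact NonUnitalStarAlgHom.norm_apply_le _ a⟩⟩
  map_one' := by ext1; funext ρ; exact map_one (ρ.restrict (h ρ)).eval
  map_mul' a b := by ext1; funext ρ; exact map_mul (ρ.restrict (h ρ)).eval a b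
  map_zero' := by ext1; funext ρ; exact map_zero (ρ.restrict (h ρ)).eval
  map_add' a b := by ext1; funext ρ; exact map_add (ρ.restrict (h ρ)).eval a b
  commutes' r := by ext1; funext ρ; exact AlgHomClass.commutes (ρ.restrict (h ρ)).eval r
  map_star' a := by ext1; funext ρ; exact map_star (ρ.restrict (h ρ)).eval a

theorem restrictProduct_mem (h : ∀ ρ : NicaRep P, IsNicaCovariant (ρ.V.comp S.subtype))
    (a : FullCStar S) : restrictProduct h a ∈ generatedCStar (Set.range (nicaSum P)) := by
  refine FullCStar.mem_of_univRep_mem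
    ((generatedCStar (Set.range (nicaSum P))).comap (restrictProduct h)) ?_ (fun p => ?_) a
  · exact (StarSubalgebra.isClosed_topologicalClosure _).preimage
      (map_continuous (restrictProduct h))
  · exact StarSubalgebra.le_topologicalClosure _ (StarAlgebra.subset_adjoin ℂ _ ⟨(p : P), rfl⟩)

/-- The homomorphism of full semigroup C*-algebras induced by the inclusion of a submonoid along
which Nica-covariant representations restrict. -/
def FullCStar.inclusion (h : ∀ ρ : NicaRep P, IsNicaCovariant (ρ.V.comp S.subtype)) :
    FullCStar S →⋆ₐ[ℂ] FullCStar P :=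
  (restrictProduct h).codRestrict (generatedCStar (Set.range (nicaSum P))) (restrictProduct_mem h)

theorem FullCStar.inclusion_univRep (h : ∀ ρ : NicaRep P, IsNicaCovariant (ρ.V.comp S.subtype))
    (p : S) : FullCStar.inclusion h (univRep S p) = univRep P p := rfl

/-- The range of an isometric *-homomorphism on `C*(P)` is generated by the images of the
generators. -/
theorem FullCStar.range_eq {A : Type*} [CStarAlgebra A] (φ : FullCStar P →⋆ₐ[ℂ] A)
    (hφ : Isometry φ) : φ.range = generatedCStar (Set.range fun p => φ (univRep P p)) := by
  apply le_antisymm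
  · rintro _ ⟨a, rfl⟩
    refine FullCStar.mem_of_univRep_mem ((generatedCStar _).comap φ) ?_ (fun p => ?_) a
    · exact (StarSubalgebra.isClosed_topologicalClosure _).preimage hφ.continuous
    · exact StarSubalgebra.le_topologicalClosure _ (StarAlgebra.subset_adjoin ℂ _ ⟨p, rfl⟩)
  · refine StarSubalgebra.topologicalClosure_minimal (StarAlgebra.adjoin_le ?_) ?_
    · rintro _ ⟨p, rfl⟩
      exact ⟨_, rfl⟩
    -- An isometric image of a complete space is closed, so the range contains the closure of the
    -- generated *-algebra.
    · have := hφ.isClosedEmbedding.isClosed_range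
      exact this

end Restriction

end

/-! ### Injectivity of the induced homomorphism -/

theorem corollary3p7 {P : Type*} [Monoid P] (hP : IsRightLCM P) (P₁ : Submonoid P)
    (hfact : ClosedUnderFactorization P₁) (horth : PreservesOrthogonality P₁) :
    ∃ φ : FullCStar P₁ →⋆ₐ[ℂ] FullCStar P,
      (∀ p : P₁, φ (univRep P₁ p) = univRep P (p : P)) ∧
      Function.Injective φ ∧ Isometry φ ∧
      φ.range = generatedCStar (univRep P '' (P₁ : Set P)) := by
  have := hP.isLeftCancelMul
  have hlcm := hP.exists_isRightLcm
  have hres : ∀ ρ : NicaRep P, IsNicaCovariant (ρ.V.comp P₁.subtype) := fun ρ =>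
    ρ.isNicaCovariant.restrict hfact horth hlcm
  have hinj : Function.Injective (FullCStar.inclusion hres) := by
    intro a b hab
    -- Representations of `P₁` separate points of its full C*-algebra, so it is enough to dilate
    -- each of them.
    refine FullCStar.ext_eval fun ρ => ?_
    obtain ⟨E, _, _, _, W, j, hW, hj, hint⟩ := exists_dilation
      (isExtendedNica_extendByZero hfact horth hlcm ρ.isNicaCovariant) hfact hlcm
    obtain ⟨π, hπ, -⟩ := existsUnique_lift W hW
    have key : ∀ c, π (FullCStar.inclusion hres c) ∘L j = j ∘L ρ.eval c := by
      refine FullCStar.intertwine ρ.eval (π.comp (FullCStar.inclusion hres)) j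
        (fun p => ?_) fun p => ?_
      · rw [StarAlgHom.comp_apply, FullCStar.inclusion_univRep, hπ, (hint p p.2).1,
          extendByZero_coe]
        rfl
      · rw [StarAlgHom.comp_apply, FullCStar.inclusion_univRep, hπ, (hint p p.2).2,
          extendByZero_coe]
        rfl
    ext v
    apply hj
    -- Equal images in `FullCStar P` give equal operators on the dilation space, and injectivity of
    -- j carries this back to ρ.
    have h := (key a).symm.trans ((congrArg (fun c => π c ∘L j) hab).trans (key b))
    exact DFunLike.congr_fun h v
  have hiso : Isometry (FullCStar.inclusion hres) := NonUnitalStarAlgHom.isometry _ hinj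
  refine ⟨FullCStar.inclusion hres, FullCStar.inclusion_univRep hres, hinj, hiso, ?_⟩
  rw [FullCStar.range_eq _ hiso]
  congr 1
  ext z
  simp [FullCStar.inclusion_univRep]
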